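/- Let $n\ge 0$ be an integer. A binary code of length $n$ is a linear subspace $C\subseteq\mathbb F_2^n$; it is self-orthogonal if $\sum_i x_iy_i=0$ for all $x,y\in C$. Two codes of length $n$ are equivalent if some permutation of the $n$ coordinates maps one onto the other. Let $\Psi_{k,n}$ (resp. $\Psi_{\le k,n}$) be the number of equivalence classes of self-orthogonal codes of length $n$ and dimension exactly $k$ (resp. at most $k$). A partition $\lambda\vdash n$ is a sequence $\lambda=(\lambda_1,\lambda_2,\dots)$ of nonnegative integers with $\sum_{i\ge1} i\lambda_i=n$ ($\lambda_i$ is the number of parts equal to $i$). Put $\lambda_{a,b}=\sum_{i\ge 1,\ i\equiv a\,(\mathrm{mod}\ b)}\lambda_i$, and let $\delta(m)=1$ if $m>0$ and $\delta(m)=0$ if $m\le0$. For $A\in\mathrm{GL}(k,\mathbb F_2)$ and an $n\times n$ permutation matrix $P$ let $$\mathrm{Fix}(A,P)=\{X\in M_{k\times n}(\mathbb F_2): XX^T=0,\ A^{-1}XP=X\}.$$ Let $$A_1=I_3,\quad A_2=\begin{bmatrix}1&0&0\\0&0&1\\0&1&0\end{bmatrix},\quad A_3=\begin{bmatrix}0&1&0\\0&0&1\\1&1&1\end{bmatrix},\quad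 A_4=\begin{bmatrix}1&0&0\\0&0&1\\0&1&1\end{bmatrix},\quad A_5=\begin{bmatrix}0&1&0\\0&0&1\\1&1&0\end{bmatrix},\quad A_6=\begin{bmatrix}0&1&0\\0&0&1\\1&0&1\end{bmatrix}.$$ Then: 1. $A_1,\dots,A_6$ is a set of representatives of the conjugacy classes of $\mathrm{GL}(3,\mathbb F_2)$ (each class is represented exactly once), and their centralizers have orders $c_1=168$, $c_2=8$, $c_3=4$, $c_4=3$, $c_5=7$, $c_6=7$. 2. Every partition $\lambda\vdash n$ is the cycle type of a permutation of $n$ points, and for every $\lambda\vdash n$ and every permutation matrix $P_\lambda$ of cycle type $\lambda$ one has $|\mathrm{Fix}(A_i,P_\lambda)|=F_i(\lambda)$ for $i=1,\dots,6$, where $$\begin{aligned} F_1(\lambda)&=2^{3\lambda_{0,2}}\Bigl[2^{3\lambda_{1,2}-6}\bigl(36-35\,\delta(\lambda_{1,2})\bigr)+2^{2\lambda_{1,2}-6}\cdot 7\bigl(3+(-1)^{\lambda_{1,2}}\bigr)\Bigr],\\ F_2(\lambda)&=2^{3\lambda_{0,4}}\Bigl[2^{2\lambda_{1,2}+3\lambda_{2,4}-4}\bigl(8-3\delta(\lambda_{1,2})-\delta(\lambda_{2,4})-3\delta(\lambda_{1,2}+\lambda_{2,4})\bigr)+2^{\lambda_{1,2}+2\lambda_{2,4}-3}\bigl(3+(-1)^{\lambda_{1,2}}\bigr)\Bigr],\\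 F_3(\lambda)&=2^{\lambda_{1,2}+2\lambda_{2,4}+3\lambda_{0,4}-2}\bigl[4-\delta(\lambda_{1,2}+\lambda_{2,4})-\delta(\lambda_{1,2}+\lambda_{4,8})-\delta(\lambda_{2,4}+\lambda_{4,8})\bigr],\\ F_4(\lambda)&=2^{\lambda_{0,1}+2\lambda_{0,6}-2}\bigl(2-\delta(\lambda_{1,2})\bigr)\bigl[2^{2\lambda_{3,6}}+(-1)^{\lambda_{3,6}}2^{\lambda_{3,6}}\bigr],\\ F_5(\lambda)&=F_6(\lambda)=2^{3\lambda_{0,7}}. \end{aligned}$$ 3. Consequently $$\Psi_{\le 3,n}=\sum_{i=1}^{6}\frac1{c_i}\sum_{\lambda\vdash n}\frac{F_i(\lambda)}{\lambda_1!\,\lambda_2!\cdots 1^{\lambda_1}2^{\lambda_2}\cdots},\qquad \Psi_{3,n}=\Psi_{\le 3,n}-\Psi_{\le 2,n}.$$ -/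

import Mathlib

open scoped BigOperators Nat

/-! ### Binary self-orthogonal codes up to permutation of the coordinates -/

/-- A binary code `C ⊆ 𝔽₂ⁿ` is self-orthogonal if `⟨x, y⟩ = 0` for all `x, y ∈ C`,
i.e. `C ⊆ C^⊥`. -/
def IsSelfOrthogonal {n : ℕ} (C : Submodule (ZMod 2) (Fin n → ZMod 2)) : Prop :=
  ∀ x ∈ C, ∀ y ∈ C, x ⬝ᵥ y = 0

/-- The image of a code under a permutation of the coordinates. -/
def permuteCode {n : ℕ} (σ : Equiv.Perm (Fin n)) (C : Submodule (ZMod 2) (Fin n → ZMod 2)) :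
    Submodule (ZMod 2) (Fin n → ZMod 2) :=
  C.map (LinearEquiv.funCongrLeft (ZMod 2) (ZMod 2) σ : (Fin n → ZMod 2) →ₗ[ZMod 2] (Fin n → ZMod 2))

/-- Two codes of length `n` are equivalent if a permutation of the coordinates carries one
to the other. -/
def codeSetoid (n : ℕ) : Setoid (Submodule (ZMod 2) (Fin n → ZMod 2)) where
  r C₁ C₂ := ∃ σ : Equiv.Perm (Fin n), C₂ = permuteCode σ C₁
  iseqv :=
    { refl := fun C => ⟨1, by ext x; simp [permuteCode, LinearEquiv.funCongrLeft, LinearMap.funLeft]⟩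
      symm := by
        rintro C₁ _ ⟨σ, rfl⟩
        refine ⟨σ⁻¹, ?_⟩
        unfold permuteCode
        rw [← Submodule.map_comp]
        have : ((LinearEquiv.funCongrLeft (ZMod 2) (ZMod 2) σ⁻¹ :
              (Fin n → ZMod 2) →ₗ[ZMod 2] (Fin n → ZMod 2)) ∘ₗ
            (LinearEquiv.funCongrLeft (ZMod 2) (ZMod 2) σ :
              (Fin n → ZMod 2) →ₗ[ZMod 2] (Fin n → ZMod 2))) = LinearMap.id := by
          ext f i
          simp [LinearMap.funLeft]
        rw [this, Submodule.map_id]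
      trans := by
        rintro C₁ _ _ ⟨σ, rfl⟩ ⟨τ, rfl⟩
        refine ⟨σ * τ, ?_⟩
        unfold permuteCode
        rw [← Submodule.map_comp]
        rfl }

/-- `Ψ_{k,n}`: the number of inequivalent self-orthogonal codes of length `n` and
dimension exactly `k`. -/
noncomputable def Psi (k n : ℕ) : ℕ :=
  Nat.card (Quotient ((codeSetoid n).comap
    (Subtype.val : {C : Submodule (ZMod 2) (Fin n → ZMod 2) //
      IsSelfOrthogonal C ∧ Module.finrank (ZMod 2) C = k} → _)))

/-- `Ψ_{≤k,n}`: the number of inequivalent self-orthogonal codes of length `n` and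
dimension at most `k`. -/
noncomputable def PsiLE (k n : ℕ) : ℕ :=
  Nat.card (Quotient ((codeSetoid n).comap
    (Subtype.val : {C : Submodule (ZMod 2) (Fin n → ZMod 2) //
      IsSelfOrthogonal C ∧ Module.finrank (ZMod 2) C ≤ k} → _)))

/-! ### Fixed points of the action of `GL(k, 𝔽₂) × 𝔖ₙ` -/

/-- `S_{k×n} = {X ∈ M_{k×n}(𝔽₂) : X Xᵀ = 0}`. -/
def selfOrthMatrices (k n : ℕ) : Set (Matrix (Fin k) (Fin n) (ZMod 2)) :=
  {X | X * X.transpose = 0}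

/-- `Fix(A, P) = {X ∈ S_{k×n} : A⁻¹ X P = X}`, with `P` the permutation matrix of `σ`. -/
def FixSet {k n : ℕ} (A : GL (Fin k) (ZMod 2)) (σ : Equiv.Perm (Fin n)) :
    Set (Matrix (Fin k) (Fin n) (ZMod 2)) :=
  {X | X ∈ selfOrthMatrices k n ∧
    ((A⁻¹ : GL (Fin k) (ZMod 2)) : Matrix (Fin k) (Fin k) (ZMod 2)) * X *
      Equiv.Perm.permMatrix (ZMod 2) σ = X}

/-- The six matrices `A₁, …, A₆` (indexed from `0`), as plain matrices. -/
def repMatrix : Fin 6 → Matrix (Fin 3) (Fin 3) (ZMod 2)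
  | 0 => !![1, 0, 0; 0, 1, 0; 0, 0, 1]
  | 1 => !![1, 0, 0; 0, 0, 1; 0, 1, 0]
  | 2 => !![0, 1, 0; 0, 0, 1; 1, 1, 1]
  | 3 => !![1, 0, 0; 0, 0, 1; 0, 1, 1]
  | 4 => !![0, 1, 0; 0, 0, 1; 1, 1, 0]
  | 5 => !![0, 1, 0; 0, 0, 1; 1, 0, 1]

theorem repMatrix_det_ne_zero (i : Fin 6) : (repMatrix i).det ≠ 0 := by
  fin_cases i <;> simp [repMatrix, Matrix.det_fin_three]

/-- The six matrices `A₁, …, A₆` as elements of `GL(3, 𝔽₂)`. -/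
noncomputable def repGL (i : Fin 6) : GL (Fin 3) (ZMod 2) :=
  Matrix.GeneralLinearGroup.mkOfDetNeZero (repMatrix i) (repMatrix_det_ne_zero i)

/-- The orders of the centralizers of `A₁, …, A₆` in `GL(3, 𝔽₂)`. -/
def centOrder : Fin 6 → ℕ
  | 0 => 2 ^ 3 * 3 * 7
  | 1 => 2 ^ 3
  | 2 => 2 ^ 2
  | 3 => 3
  | 4 => 7
  | 5 => 7

/-! ### Partitions and the closed formulas -/

/-- `λ_i`: the number of parts of `lam` that are equal to `i`. -/
def partMult {n : ℕ} (lam : n.Partition) (i : ℕ) : ℕ := lam.parts.count i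

/-- `λ_{a,b} = ∑ λ_i` over all `i ≥ 1` with `i ≡ a (mod b)`. (Parts of `lam` are at most `n`.) -/
def partSum {n : ℕ} (lam : n.Partition) (a b : ℕ) : ℕ :=
  ∑ i ∈ (Finset.Icc 1 n).filter (fun i => i ≡ a [MOD b]), partMult lam i

/-- `λ₁! λ₂! ⋯ 1^{λ₁} 2^{λ₂} ⋯`. -/
def centSymOrder {n : ℕ} (lam : n.Partition) : ℕ :=
  ∏ i ∈ Finset.Icc 1 n, (partMult lam i)! * i ^ partMult lam i

/-- `δ(m) = 1` if `m > 0` and `δ(m) = 0` otherwise. -/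
def delta (m : ℤ) : ℚ := if 0 < m then 1 else 0

/-- The closed expressions, in terms of the `λ_{a,b}`, attached to `A₁, …, A₆`.
Exponents are integers, so powers of `2` may be negative. -/
def fixFormula {n : ℕ} (lam : n.Partition) : Fin 6 → ℚ
  | 0 => (2 : ℚ) ^ (3 * (partSum lam 0 2 : ℤ)) *
      ((2 : ℚ) ^ (3 * (partSum lam 1 2 : ℤ) - 6) * (36 - 35 * delta (partSum lam 1 2)) +
        (2 : ℚ) ^ (2 * (partSum lam 1 2 : ℤ) - 6) * 7 * (3 + (-1 : ℚ) ^ partSum lam 1 2))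
  | 1 => (2 : ℚ) ^ (3 * (partSum lam 0 4 : ℤ)) *
      ((2 : ℚ) ^ (2 * (partSum lam 1 2 : ℤ) + 3 * (partSum lam 2 4 : ℤ) - 4) *
          (8 - 3 * delta (partSum lam 1 2) - delta (partSum lam 2 4) -
            3 * delta ((partSum lam 1 2 : ℤ) + (partSum lam 2 4 : ℤ))) +
        (2 : ℚ) ^ ((partSum lam 1 2 : ℤ) + 2 * (partSum lam 2 4 : ℤ) - 3) *
          (3 + (-1 : ℚ) ^ partSum lam 1 2))
  | 2 => (2 : ℚ) ^ ((partSum lam 1 2 : ℤ) + 2 * (partSum lam 2 4 : ℤ) +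
        3 * (partSum lam 0 4 : ℤ) - 2) *
      (4 - delta ((partSum lam 1 2 : ℤ) + (partSum lam 2 4 : ℤ)) -
        delta ((partSum lam 1 2 : ℤ) + (partSum lam 4 8 : ℤ)) -
        delta ((partSum lam 2 4 : ℤ) + (partSum lam 4 8 : ℤ)))
  | 3 => (2 : ℚ) ^ ((partSum lam 0 1 : ℤ) + 2 * (partSum lam 0 6 : ℤ) - 2) *
      (2 - delta (partSum lam 1 2)) *
      ((2 : ℚ) ^ (2 * (partSum lam 3 6 : ℤ)) +
        (-1 : ℚ) ^ partSum lam 3 6 * (2 : ℚ) ^ (partSum lam 3 6 : ℤ))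
  | 4 => (2 : ℚ) ^ (3 * (partSum lam 0 7 : ℤ))
  | 5 => (2 : ℚ) ^ (3 * (partSum lam 0 7 : ℤ))

/-!
A code of dimension at most `3` is the row space of a `3 × n` matrix `X`, and it is self-orthogonal
exactly when `X Xᵀ = 0`. Two matrices have the same row space iff they differ by an element of
`GL(3, 𝔽₂)`, so equivalence classes of codes are the orbits of `GL(3, 𝔽₂) × 𝔖ₙ` on such matrices
(`PsiLE_eq_card_orbits`). Burnside's lemma expresses their number through the numbers
`|Fix(A, P)|`, which depend only on the conjugacy classes of `A` and `P` (`PsiLE_three_eq`).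

The condition `A⁻¹ X P = X` says that the columns of `X` form an equivariant function from the `n`
points to `𝔽₂³`. The condition `X Xᵀ = 0` is imposed by summing over the `64` characters of the
space of symmetric `3 × 3` matrices, that is, over the quadratic forms `q` in three variables:
`64 |Fix(A, P)| = ∑ q, ∑ x, ∏ j, (-1) ^ q(x j)`, where `x` runs over the equivariant functions
(`sum_equivariantSum_quadSign`). For fixed `q` the inner sum factors over the cycles of the
permutation, a cycle of length `m` contributing a weight that depends on `A`, `q` and `m`
(`equivariantSum_eq_prod_cycleWeight`). As a function of `m` this weight has a small period
(`periodic_cycleWeight`), so the product only involves the numbers `λ_{a,b}` and finitely many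
weights. These weights are computed for each of the six representatives (`weightTable`), and the
resulting exponential sums are the closed formulas (`card_fixSet_eq_fixFormula`).

That the six matrices represent all conjugacy classes follows from the orders of their
centralizers: the classes are disjoint and `168 / 168 + 168 / 8 + 168 / 4 + 168 / 3 + 168 / 7 +
168 / 7 = 168` (`existsUnique_isConj_repGL`).
-/

/-! ### Equivariant functions and cycle type -/

/-- The sum of `∏ a, f (x a)` over all functions `x : α → V` that intertwine the permutation `σ`
of `α` with the map `T` of `V`. -/
def equivariantSum {α V R : Type*} [Fintype α] [DecidableEq α] [Fintype V] [DecidableEq V]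
    [CommSemiring R] (σ : Equiv.Perm α) (T : V → V) (f : V → R) : R :=
  ∑ x : α → V, if ∀ a, x (σ a) = T (x a) then ∏ a, f (x a) else 0

/-- The contribution of a cycle of length `m` to `equivariantSum`: an equivariant function on the
cycle is determined by its value `v` at one point, which can be any solution of `T ^ m v = v`. -/
def cycleWeight {V R : Type*} [Fintype V] [DecidableEq V] [CommSemiring R] (T : V → V) (f : V → R)
    (m : ℕ) : R :=
  ∑ v, if T^[m] v = v then ∏ t ∈ Finset.range m, f (T^[t] v) else 0

section EquivariantSum

variable {α β V R : Type*} [Fintype α] [DecidableEq α] [Fintype β] [DecidableEq β] [Fintype V]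
  [DecidableEq V] [CommSemiring R]

theorem equivariantSum_eq_sum_filter (σ : Equiv.Perm α) (T : V → V) (f : V → R) :
    equivariantSum σ T f = ∑ x : α → V with ∀ a, x (σ a) = T (x a), ∏ a, f (x a) :=
  (Finset.sum_filter _ _).symm

theorem equivariantSum_permCongr (e : α ≃ β) (σ : Equiv.Perm α) (T : V → V) (f : V → R) :
    equivariantSum (e.permCongr σ) T f = equivariantSum σ T f := by
  unfold equivariantSum
  refine Fintype.sum_equiv (e.symm.arrowCongr (Equiv.refl V)) _ _ fun x => ?_
  have h1 : (∀ b, x (e.permCongr σ b) = T (x b)) ↔ ∀ a, x (e (σ a)) = T (x (e a)) :=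
    ⟨fun h a => by simpa using h (e a), fun h b => by simpa using h (e.symm b)⟩
  have h2 : ∏ b, f (x b) = ∏ a, f (x (e a)) := (Equiv.prod_comp e fun b => f (x b)).symm
  exact if_congr h1 h2 rfl

theorem equivariantSum_sumCongr (σ : Equiv.Perm α) (τ : Equiv.Perm β) (T : V → V) (f : V → R) :
    equivariantSum (Equiv.Perm.sumCongr σ τ) T f = equivariantSum σ T f * equivariantSum τ T f := by
  unfold equivariantSum
  rw [Finset.sum_mul_sum, ← Finset.sum_product', Finset.univ_product_univ]
  refine Fintype.sum_equiv (Equiv.sumArrowEquivProdArrow α β V) _ _ fun x => ?_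
  rw [ite_zero_mul_ite_zero]
  refine if_congr ?_ (Fintype.prod_sum_type _) rfl
  simp [Sum.forall]

theorem equivariantSum_finRotate (m : ℕ) (T : V → V) (f : V → R) :
    equivariantSum (finRotate (m + 1)) T f = cycleWeight T f (m + 1) := by
  rw [equivariantSum_eq_sum_filter, cycleWeight, ← Finset.sum_filter]
  have key : ∀ x : Fin (m + 1) → V, (∀ a, x (finRotate (m + 1) a) = T (x a)) →
      ∀ k (hk : k < m + 1), x ⟨k, hk⟩ = T^[k] (x 0) := by
    intro x hx k
    induction k with
    | zero => intro _; rfl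
    | succ k ih =>
      intro hk
      rw [Function.iterate_succ_apply', ← ih (by omega), ← hx, finRotate_of_lt (by omega)]
  refine Finset.sum_bij' (fun x _ => x 0) (fun v _ i => T^[i.val] v) ?_ ?_ ?_ ?_ ?_
  · intro x hx
    simp only [Finset.mem_filter, Finset.mem_univ, true_and] at hx ⊢
    rw [Function.iterate_succ_apply', ← key x hx m (by omega), ← hx]
    congr 1
    exact finRotate_last'
  · intro v hv
    simp only [Finset.mem_filter, Finset.mem_univ, true_and] at hv ⊢
    rintro ⟨i, hi⟩
    rcases (Nat.lt_succ_iff.mp hi).lt_or_eq with h | rfl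
    · rw [finRotate_of_lt h, ← Function.iterate_succ_apply' T]
    · rw [finRotate_last', ← Function.iterate_succ_apply' T, hv]
      rfl
  · intro x hx
    simp only [Finset.mem_filter, Finset.mem_univ, true_and] at hx
    funext i
    exact (key x hx i i.2).symm
  · intro v _
    rfl
  · intro x hx
    simp only [Finset.mem_filter, Finset.mem_univ, true_and] at hx
    rw [← Fin.prod_univ_eq_prod_range (fun t => f (T^[t] (x 0)))]
    exact Finset.prod_congr rfl fun i _ => by rw [← key x hx i i.2]

end EquivariantSum

section PartitionOfPerm

variable {α β : Type*} [Fintype α] [DecidableEq α] [Fintype β] [DecidableEq β]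

theorem parts_partition_eq (σ : Equiv.Perm α) :
    σ.partition.parts =
      σ.cycleType + Multiset.replicate (Fintype.card α - σ.cycleType.sum) 1 := by
  rw [Equiv.Perm.parts_partition, Equiv.Perm.sum_cycleType]

theorem cycleType_permCongr (e : α ≃ β) (σ : Equiv.Perm α) :
    (e.permCongr σ).cycleType = σ.cycleType := by
  have h : e.permCongr σ
      = σ.extendDomain (e.trans (Equiv.subtypeUnivEquiv (p := fun _ : β => True)
          fun _ => trivial).symm) := by
    ext b
    rw [Equiv.Perm.extendDomain_apply_subtype _ _ trivial]
    rfl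
  rw [h, Equiv.Perm.cycleType_extendDomain]

theorem cycleType_sumCongr_one (σ : Equiv.Perm α) :
    (Equiv.Perm.sumCongr σ (1 : Equiv.Perm β)).cycleType = σ.cycleType := by
  classical
  have h : Equiv.Perm.sumCongr σ (1 : Equiv.Perm β)
      = σ.extendDomain (Equiv.ofInjective (Sum.inl : α → α ⊕ β) Sum.inl_injective) := by
    ext (a | b)
    · have := Equiv.Perm.extendDomain_apply_image σ
        (Equiv.ofInjective (Sum.inl : α → α ⊕ β) Sum.inl_injective) a
      simpa using this.symm
    · rw [Equiv.Perm.extendDomain_apply_not_subtype _ _ (by simp)]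
      simp
  rw [h, Equiv.Perm.cycleType_extendDomain]

theorem cycleType_sumCongr (σ : Equiv.Perm α) (τ : Equiv.Perm β) :
    (Equiv.Perm.sumCongr σ τ).cycleType = σ.cycleType + τ.cycleType := by
  have hτ : (Equiv.Perm.sumCongr (1 : Equiv.Perm α) τ).cycleType = τ.cycleType := by
    rw [← cycleType_sumCongr_one (β := α) τ, ← cycleType_permCongr (Equiv.sumComm α β)]
    congr 1
    ext (a | b) <;> simp
  have hmul : Equiv.Perm.sumCongr σ τ = Equiv.Perm.sumCongr σ 1 * Equiv.Perm.sumCongr 1 τ := by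
    ext (a | b) <;> simp
  have hdisj : (Equiv.Perm.sumCongr σ (1 : Equiv.Perm β)).Disjoint (Equiv.Perm.sumCongr 1 τ) := by
    rintro (a | b) <;> simp
  rw [hmul, hdisj.cycleType_mul, hτ, cycleType_sumCongr_one]

theorem parts_partition_sumCongr (σ : Equiv.Perm α) (τ : Equiv.Perm β) :
    (Equiv.Perm.sumCongr σ τ).partition.parts =
      σ.partition.parts + τ.partition.parts := by
  have h1 := σ.sum_cycleType_le
  have h2 := τ.sum_cycleType_le
  have h3 : Fintype.card (α ⊕ β) - (σ.cycleType + τ.cycleType).sum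
      = (Fintype.card α - σ.cycleType.sum) + (Fintype.card β - τ.cycleType.sum) := by
    rw [Multiset.sum_add, Fintype.card_sum]
    omega
  rw [parts_partition_eq, parts_partition_eq, parts_partition_eq, cycleType_sumCongr, h3,
    Multiset.replicate_add]
  abel

theorem parts_partition_finRotate (m : ℕ) : (finRotate (m + 1)).partition.parts = {m + 1} := by
  rcases m with _ | m
  · rw [parts_partition_eq, show finRotate (0 + 1) = 1 from
      Equiv.ext fun _ => Subsingleton.elim (α := Fin 1) _ _]
    simp
  · rw [parts_partition_eq, cycleType_finRotate]
    simp

theorem parts_partition_permCongr (e : α ≃ β) (σ : Equiv.Perm α) :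
    (e.permCongr σ).partition.parts = σ.partition.parts := by
  rw [parts_partition_eq, parts_partition_eq, cycleType_permCongr, Fintype.card_congr e]

/-- A permutation with prescribed cycle lengths, built as a disjoint union of rotations, for which
`equivariantSum` factors over the cycles. -/
theorem exists_perm_parts_eq_and_equivariantSum_eq_prod {V R : Type*} [Fintype V] [DecidableEq V]
    [CommSemiring R] (T : V → V) (f : V → R) (s : Multiset ℕ) (hs : ∀ m ∈ s, 0 < m) :
    ∃ (k : ℕ) (σ : Equiv.Perm (Fin k)), σ.partition.parts = s ∧
      equivariantSum σ T f = (s.map (cycleWeight T f)).prod := by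
  induction s using Multiset.induction_on with
  | empty =>
    refine ⟨0, 1, ?_, ?_⟩
    · rw [parts_partition_eq]
      simp
    · simp [equivariantSum]
  | cons m s ih =>
    obtain ⟨k, σ, hσ, hsum⟩ := ih fun i hi => hs i (Multiset.mem_cons_of_mem hi)
    obtain ⟨m, rfl⟩ := Nat.exists_eq_succ_of_ne_zero (hs m (Multiset.mem_cons_self m s)).ne'
    refine ⟨m + 1 + k, finSumFinEquiv.permCongr (Equiv.Perm.sumCongr (finRotate (m + 1)) σ), ?_, ?_⟩
    · rw [parts_partition_permCongr, parts_partition_sumCongr, parts_partition_finRotate, hσ]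
      rfl
    · rw [equivariantSum_permCongr, equivariantSum_sumCongr, equivariantSum_finRotate, hsum]
      simp

/-- `equivariantSum` is multiplicative over the cycles of the permutation. -/
theorem equivariantSum_eq_prod_cycleWeight {V R : Type*} [Fintype V] [DecidableEq V]
    [CommSemiring R] (T : V → V) (f : V → R) (σ : Equiv.Perm α) :
    equivariantSum σ T f = (σ.partition.parts.map (cycleWeight T f)).prod := by
  obtain ⟨k, τ, hτ, hsum⟩ := exists_perm_parts_eq_and_equivariantSum_eq_prod T f σ.partition.parts
    fun m hm => σ.partition.parts_pos hm
  have hcard : Fintype.card (Fin k) = Fintype.card α := by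
    rw [← τ.partition.parts_sum, hτ, σ.partition.parts_sum]
  obtain ⟨e⟩ := Fintype.card_eq.mp hcard
  have hconj : IsConj (e.permCongr τ) σ := by
    rw [Equiv.Perm.partition_eq_of_isConj]
    exact Nat.Partition.ext ((parts_partition_permCongr e τ).trans hτ)
  obtain ⟨c, hc⟩ := isConj_iff.mp hconj
  have hc' : (Equiv.permCongr c) (e.permCongr τ) = σ := by
    rw [← hc]
    rfl
  rw [← hsum, ← equivariantSum_permCongr e τ, ← hc', equivariantSum_permCongr c]

/-- Every partition of `n` is the cycle type of a permutation of `n` points. -/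
theorem exists_perm_parts_partition_eq {n : ℕ} (lam : n.Partition) :
    ∃ σ : Equiv.Perm (Fin n), σ.partition.parts = lam.parts := by
  obtain ⟨k, τ, hτ, -⟩ := exists_perm_parts_eq_and_equivariantSum_eq_prod (V := Unit) (R := ℕ) id 1
    lam.parts fun m hm => lam.parts_pos hm
  obtain rfl : k = n := by
    rw [← lam.parts_sum, ← hτ, τ.partition.parts_sum, Fintype.card_fin]
  exact ⟨τ, hτ⟩

end PartitionOfPerm

/-! ### Cycle weights with periodic dependence on the cycle length -/

/-- If the product of `f` along any `L` consecutive iterates of `T` is `1` and `T ^ L = 1`, then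
cycle weights depend only on the cycle length modulo `L`. -/
theorem periodic_cycleWeight {V R : Type*} [Fintype V] [DecidableEq V] [CommSemiring R]
    {T : V → V} {f : V → R} {L : ℕ} (hT : ∀ v, T^[L] v = v)
    (hf : ∀ v, ∏ t ∈ Finset.range L, f (T^[t] v) = 1) :
    Function.Periodic (cycleWeight T f) L := by
  intro m
  unfold cycleWeight
  refine Finset.sum_congr rfl fun v _ => ?_
  have h1 : T^[m + L] v = T^[m] v := by rw [add_comm, Function.iterate_add_apply, hT]
  have h2 : ∏ t ∈ Finset.range (m + L), f (T^[t] v) = ∏ t ∈ Finset.range m, f (T^[t] v) := by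
    rw [Finset.prod_range_add]
    have h3 : ∀ t, T^[m + t] v = T^[t] (T^[m] v) := fun t => by
      rw [add_comm, Function.iterate_add_apply]
    simp only [h3, hf, mul_one]
  rw [h1, h2]

/-- A product of a periodic function over the parts of a partition only involves the numbers of
parts in the residue classes; these are represented by `1, …, L`. -/
theorem prod_map_parts_of_periodic {R : Type*} [CommSemiring R] {n : ℕ} (lam : n.Partition)
    {W : ℕ → R} {L : ℕ} (hL : 0 < L) (hW : Function.Periodic W L) :
    (lam.parts.map W).prod = ∏ r ∈ Finset.range L, W (r + 1) ^ partSum lam (r + 1) L := by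
  have hsub : lam.parts.toFinset ⊆ Finset.Icc 1 n := by
    intro i hi
    rw [Multiset.mem_toFinset] at hi
    exact Finset.mem_Icc.mpr ⟨lam.parts_pos hi,
      (Multiset.single_le_sum (fun _ _ => Nat.zero_le _) i hi).trans lam.parts_sum.le⟩
  have hWmod : ∀ i j, i ≡ j [MOD L] → W i = W j := fun i j hij => by
    rw [← hW.map_mod_nat i, ← hW.map_mod_nat j, hij]
  calc (lam.parts.map W).prod = ∏ i ∈ Finset.Icc 1 n, W i ^ lam.parts.count i := by
        rw [Finset.prod_multiset_map_count]
        refine Finset.prod_subset hsub fun i _ hi => ?_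
        rw [Multiset.mem_toFinset] at hi
        rw [Multiset.count_eq_zero_of_notMem hi, pow_zero]
    _ = ∏ i ∈ Finset.Icc 1 n, ∏ r ∈ Finset.range L,
          if i ≡ r + 1 [MOD L] then W (r + 1) ^ lam.parts.count i else 1 := by
        refine Finset.prod_congr rfl fun i hi => ?_
        obtain ⟨j, rfl⟩ := Nat.exists_eq_succ_of_ne_zero
          (Nat.one_le_iff_ne_zero.mp (Finset.mem_Icc.mp hi).1)
        have hj : j.succ ≡ j % L + 1 [MOD L] := (Nat.mod_modEq j L).symm.add_right 1
        rw [Finset.prod_eq_single (j % L), if_pos hj, hWmod _ _ hj]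
        · intro r hr hne
          refine if_neg fun h => hne ?_
          have h' : j ≡ r [MOD L] := Nat.ModEq.add_right_cancel' 1 h
          rw [h', Nat.mod_eq_of_lt (Finset.mem_range.mp hr)]
        · intro h
          exact absurd (Finset.mem_range.mpr (Nat.mod_lt j hL)) h
    _ = ∏ r ∈ Finset.range L, W (r + 1) ^ partSum lam (r + 1) L := by
        rw [Finset.prod_comm]
        refine Finset.prod_congr rfl fun r _ => ?_
        rw [partSum, ← Finset.prod_pow_eq_pow_sum, Finset.prod_filter]
        rfl

/-! ### Character sums counting the fixed matrices -/

/-- The sign character of the additive group of `𝔽₂`. -/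
def signChar (a : ZMod 2) : ℤ := if a = 0 then 1 else -1

theorem signChar_sum {ι : Type*} (s : Finset ι) (g : ι → ZMod 2) :
    signChar (∑ i ∈ s, g i) = ∏ i ∈ s, signChar (g i) := by
  have hadd : ∀ a b, signChar (a + b) = signChar a * signChar b := by decide
  classical
  induction s using Finset.induction_on with
  | empty => rfl
  | insert i s hi ih => rw [Finset.sum_insert hi, Finset.prod_insert hi, hadd, ih]

/-- The coefficients of a quadratic form in three variables over `𝔽₂`, in the order
`x₀x₀, x₀x₁, x₀x₂, x₁x₁, x₁x₂, x₂x₂`. -/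
abbrev QuadCoeff : Type := ZMod 2 × ZMod 2 × ZMod 2 × ZMod 2 × ZMod 2 × ZMod 2

/-- The value of a linear form with the given coefficients on the upper triangle of a
`3 × 3` matrix. -/
def QuadCoeff.pairing (S : QuadCoeff) (M : Matrix (Fin 3) (Fin 3) (ZMod 2)) : ZMod 2 :=
  S.1 * M 0 0 + S.2.1 * M 0 1 + S.2.2.1 * M 0 2 + S.2.2.2.1 * M 1 1 + S.2.2.2.2.1 * M 1 2 +
    S.2.2.2.2.2 * M 2 2

/-- The sign `(-1) ^ q(v)` for the quadratic form `q` with coefficients `S`. -/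
def quadSign (S : QuadCoeff) (v : Fin 3 → ZMod 2) : ℤ :=
  signChar (S.pairing (Matrix.of fun i j => v i * v j))

/-- Orthogonality of characters: the sum over all quadratic forms detects the vanishing of a
symmetric matrix. -/
theorem sum_signChar_pairing {M : Matrix (Fin 3) (Fin 3) (ZMod 2)} (hM : M.IsSymm) :
    ∑ S : QuadCoeff, signChar (S.pairing M) = if M = 0 then 64 else 0 := by
  have key : ∀ e₀ e₁ e₂ e₃ e₄ e₅ : ZMod 2,
      ∑ S : QuadCoeff, signChar (S.1 * e₀ + S.2.1 * e₁ + S.2.2.1 * e₂ + S.2.2.2.1 * e₃ +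
        S.2.2.2.2.1 * e₄ + S.2.2.2.2.2 * e₅) =
      if e₀ = 0 ∧ e₁ = 0 ∧ e₂ = 0 ∧ e₃ = 0 ∧ e₄ = 0 ∧ e₅ = 0 then 64 else 0 := by
    decide +kernel
  unfold QuadCoeff.pairing
  rw [key]
  refine if_congr ⟨?_, ?_⟩ rfl rfl
  · rintro ⟨h₀, h₁, h₂, h₃, h₄, h₅⟩
    have h₆ := hM.apply 0 1
    have h₇ := hM.apply 0 2
    have h₈ := hM.apply 1 2
    ext i j
    fin_cases i <;> fin_cases j <;> simp_all
  · rintro rfl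
    simp

theorem pairing_mul_transpose {n : ℕ} (S : QuadCoeff) (X : Matrix (Fin 3) (Fin n) (ZMod 2)) :
    S.pairing (X * X.transpose) =
      ∑ j, S.pairing (Matrix.of fun i k => X i j * X k j) := by
  simp [QuadCoeff.pairing, Matrix.mul_apply, Finset.mul_sum, Finset.sum_add_distrib]

/-- The condition `A⁻¹ X P = X` says that the columns of `X` are equivariant. -/
theorem inv_mul_mul_permMatrix_eq_iff {k n : ℕ} (A : GL (Fin k) (ZMod 2))
    (σ : Equiv.Perm (Fin n)) (X : Matrix (Fin k) (Fin n) (ZMod 2)) :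
    ((A⁻¹ : GL (Fin k) (ZMod 2)) : Matrix (Fin k) (Fin k) (ZMod 2)) * X *
      Equiv.Perm.permMatrix (ZMod 2) σ = X ↔
    ∀ j, X.col (σ⁻¹ j) = A.1.mulVec (X.col j) := by
  have h1 : X * Equiv.Perm.permMatrix (ZMod 2) σ = X.submatrix id σ.symm :=
    PEquiv.mul_toMatrix_toPEquiv _ _
  rw [Matrix.mul_assoc, h1]
  have h2 : ((A⁻¹ : GL (Fin k) (ZMod 2)) : Matrix (Fin k) (Fin k) (ZMod 2)) *
      X.submatrix id σ.symm = X ↔ X.submatrix id σ.symm = A.1 * X := by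
    constructor
    · intro h
      calc X.submatrix id σ.symm = A.1 * (A⁻¹).1 * X.submatrix id σ.symm := by
            rw [← Units.val_mul, mul_inv_cancel, Units.val_one, Matrix.one_mul]
        _ = A.1 * X := by rw [Matrix.mul_assoc]; exact congrArg _ h
    · intro h
      rw [h, ← Matrix.mul_assoc, ← Units.val_mul, inv_mul_cancel, Units.val_one, Matrix.one_mul]
  rw [h2]
  constructor
  · intro h j
    ext i
    exact congrFun (congrFun h i) j
  · intro h
    ext i j
    exact congrFun (h j) i

/-- The decidability instance is an implicit argument, so that the lemma applies to whichever
instance occurs. -/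
theorem card_filter_univ_eq_natCard {β : Type*} [Fintype β] (p : β → Prop)
    {inst : DecidablePred p} : (Finset.univ.filter p).card = Nat.card {x // p x} := by
  rw [Nat.card_eq_fintype_card, Fintype.card_subtype]

/-- The number of fixed matrices as a character sum. -/
theorem sum_equivariantSum_quadSign {n : ℕ} (A : GL (Fin 3) (ZMod 2)) (σ : Equiv.Perm (Fin n)) :
    ∑ S : QuadCoeff, equivariantSum σ⁻¹ A.1.mulVec (quadSign S) =
      64 * (Nat.card (FixSet A σ) : ℤ) := by
  classical
  simp only [equivariantSum_eq_sum_filter]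
  rw [Finset.sum_comm]
  have inner : ∀ x : Fin n → Fin 3 → ZMod 2,
      ∑ S : QuadCoeff, ∏ j, quadSign S (x j) =
        if (Matrix.of x).transpose * (Matrix.of x).transpose.transpose = 0 then 64 else 0 := by
    intro x
    have hsymm : ((Matrix.of x).transpose * (Matrix.of x).transpose.transpose).IsSymm := by
      rw [Matrix.IsSymm, Matrix.transpose_mul, Matrix.transpose_transpose]
    rw [← sum_signChar_pairing hsymm]
    refine Finset.sum_congr rfl fun S _ => ?_
    rw [pairing_mul_transpose, signChar_sum]
    rfl
  simp only [inner]
  rw [← Finset.sum_filter, Finset.sum_const, Finset.filter_filter, nsmul_eq_mul, mul_comm]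
  congr 2
  rw [card_filter_univ_eq_natCard]
  refine Nat.card_congr ((Matrix.transposeAddEquiv (Fin n) (Fin 3) (ZMod 2)).toEquiv.subtypeEquiv
    fun x => ?_)
  simp only [FixSet, selfOrthMatrices, Set.mem_ofPred_eq, inv_mul_mul_permMatrix_eq_iff]
  exact and_comm

/-! ### Weight tables of the six representatives -/

/-- Multiplication by `A₁, …, A₆` on column vectors, written out in coordinates. -/
def repMap : Fin 6 → (Fin 3 → ZMod 2) → (Fin 3 → ZMod 2)
  | 0 => fun v => v
  | 1 => fun v => ![v 0, v 2, v 1]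
  | 2 => fun v => ![v 1, v 2, v 0 + v 1 + v 2]
  | 3 => fun v => ![v 0, v 2, v 1 + v 2]
  | 4 => fun v => ![v 1, v 2, v 0 + v 1]
  | 5 => fun v => ![v 1, v 2, v 0 + v 2]

theorem mulVec_repMatrix : ∀ (i : Fin 6) (v : Fin 3 → ZMod 2),
    (repMatrix i).mulVec v = repMap i v := by
  decide +kernel

/-- A period of the cycle weights of `A₁, …, A₆`. It is the order of `Aᵢ`, doubled for the
`2`-elements so that the sign collected along a full period is trivial. -/
def repPeriod : Fin 6 → ℕ
  | 0 => 2
  | 1 => 4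
  | 2 => 8
  | 3 => 6
  | 4 => 7
  | 5 => 7

theorem repPeriod_pos (i : Fin 6) : 0 < repPeriod i := by
  revert i
  decide

theorem iterate_repPeriod : ∀ (i : Fin 6) (v : Fin 3 → ZMod 2), (repMap i)^[repPeriod i] v = v := by
  decide +kernel

/-- For the elements of order `7` this holds because the values of a ternary quadratic form over all
nonzero vectors add up to zero. -/
theorem prod_quadSign_repPeriod : ∀ (i : Fin 6) (S : QuadCoeff) (v : Fin 3 → ZMod 2),
    ∏ t ∈ Finset.range (repPeriod i), quadSign S ((repMap i)^[t] v) = 1 := by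
  decide +kernel

/-- The multiset, over all quadratic forms, of the lists of cycle weights of `Aᵢ` for the cycle
lengths `1, …, repPeriod i`. -/
def weightTable (i : Fin 6) : Multiset (List ℤ) :=
  (Finset.univ : Finset QuadCoeff).val.map fun S =>
    (List.range (repPeriod i)).map fun r => cycleWeight (repMap i) (quadSign S) (r + 1)

/- For `A₁` the four entries are, in this order, the `35` forms with as many zeros as ones, the `21`
forms with six zeros, the `7` forms with two zeros, and the zero form. -/
theorem weightTable_zero : weightTable 0 =
    Multiset.replicate 35 [0, 8] + Multiset.replicate 21 [4, 8] +
      Multiset.replicate 7 [-4, 8] + Multiset.replicate 1 [8, 8] := by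
  decide +kernel

theorem weightTable_one : weightTable 1 =
    Multiset.replicate 24 [2, 4, 2, 8] + Multiset.replicate 12 [0, 0, 0, 8] +
      Multiset.replicate 12 [0, 8, 0, 8] + Multiset.replicate 8 [-2, 4, -2, 8] +
      Multiset.replicate 4 [4, 8, 4, 8] + Multiset.replicate 4 [4, 0, 4, 8] := by
  decide +kernel

theorem weightTable_two : weightTable 2 =
    Multiset.replicate 16 [2, 4, 2, 8, 2, 4, 2, 8] +
      Multiset.replicate 16 [0, 0, 0, 8, 0, 0, 0, 8] +
      Multiset.replicate 16 [0, 4, 0, 0, 0, 4, 0, 8] +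
      Multiset.replicate 16 [2, 0, 2, 0, 2, 0, 2, 8] := by
  decide +kernel

theorem weightTable_three : weightTable 3 =
    Multiset.replicate 32 [0, 2, 0, 2, 0, 8] + Multiset.replicate 16 [2, 2, 8, 2, 2, 8] +
      Multiset.replicate 16 [2, 2, -4, 2, 2, 8] := by
  decide +kernel

theorem weightTable_four : weightTable 4 = Multiset.replicate 64 [1, 1, 1, 1, 1, 1, 8] := by
  decide +kernel

theorem weightTable_five : weightTable 5 = Multiset.replicate 64 [1, 1, 1, 1, 1, 1, 8] := by
  decide +kernel

/-- The number of fixed matrices of `Aᵢ` and a permutation of cycle type `lam`, as a sum over the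
weight table. -/
theorem card_fixSet_eq_sum_weightTable {n : ℕ} (lam : n.Partition) (σ : Equiv.Perm (Fin n))
    (hσ : σ.partition.parts = lam.parts) (i : Fin 6) :
    64 * (Nat.card (FixSet (repGL i) σ) : ℤ) =
      ((weightTable i).map fun w =>
        ∏ r ∈ Finset.range (repPeriod i), w.getD r 0 ^ partSum lam (r + 1) (repPeriod i)).sum := by
  have hinv : (σ⁻¹).partition.parts = lam.parts := by
    rw [← hσ, parts_partition_eq, parts_partition_eq, Equiv.Perm.cycleType_inv]
  have hmap : (repGL i).1.mulVec = repMap i := funext fun v => mulVec_repMatrix i v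
  rw [← sum_equivariantSum_quadSign, hmap, weightTable, Multiset.map_map]
  refine Finset.sum_congr rfl fun S _ => ?_
  rw [equivariantSum_eq_prod_cycleWeight, hinv, prod_map_parts_of_periodic lam (repPeriod_pos i)
    (periodic_cycleWeight (iterate_repPeriod i) (prod_quadSign_repPeriod i S))]
  refine Finset.prod_congr rfl fun r hr => ?_
  have hr' := Finset.mem_range.mp hr
  simp [hr']

/-! ### The closed formulas -/

section PartSum

variable {n : ℕ} (lam : n.Partition)

theorem partSum_eq_sum_ite (a b : ℕ) :
    partSum lam a b = ∑ i ∈ Finset.Icc 1 n, if i ≡ a [MOD b] then partMult lam i else 0 :=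
  Finset.sum_filter _ _

theorem partSum_self (b : ℕ) : partSum lam b b = partSum lam 0 b := by
  have h : ∀ i, i ≡ b [MOD b] ↔ i ≡ 0 [MOD b] := fun i => by simp [Nat.ModEq]
  simp only [partSum, h]

theorem partSum_one_two_mod_four :
    partSum lam 1 2 = partSum lam 1 4 + partSum lam 3 4 := by
  simp only [partSum_eq_sum_ite, ← Finset.sum_add_distrib]
  refine Finset.sum_congr rfl fun i _ => ?_
  simp only [Nat.ModEq]
  grind

theorem partSum_one_two_mod_eight :
    partSum lam 1 2 =
      partSum lam 1 8 + partSum lam 3 8 + partSum lam 5 8 + partSum lam 7 8 := by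
  simp only [partSum_eq_sum_ite, ← Finset.sum_add_distrib]
  refine Finset.sum_congr rfl fun i _ => ?_
  simp only [Nat.ModEq]
  grind

theorem partSum_two_four_mod_eight :
    partSum lam 2 4 = partSum lam 2 8 + partSum lam 6 8 := by
  simp only [partSum_eq_sum_ite, ← Finset.sum_add_distrib]
  refine Finset.sum_congr rfl fun i _ => ?_
  simp only [Nat.ModEq]
  grind

theorem partSum_zero_four_mod_eight :
    partSum lam 0 4 = partSum lam 4 8 + partSum lam 0 8 := by
  simp only [partSum_eq_sum_ite, ← Finset.sum_add_distrib]
  refine Finset.sum_congr rfl fun i _ => ?_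
  simp only [Nat.ModEq]
  grind

theorem partSum_one_two_mod_six :
    partSum lam 1 2 = partSum lam 1 6 + partSum lam 3 6 + partSum lam 5 6 := by
  simp only [partSum_eq_sum_ite, ← Finset.sum_add_distrib]
  refine Finset.sum_congr rfl fun i _ => ?_
  simp only [Nat.ModEq]
  grind

theorem partSum_zero_one_mod_six :
    partSum lam 0 1 = partSum lam 1 2 + partSum lam 2 6 + partSum lam 4 6 + partSum lam 0 6 := by
  simp only [partSum_eq_sum_ite, ← Finset.sum_add_distrib]
  refine Finset.sum_congr rfl fun i _ => ?_
  simp only [Nat.ModEq]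
  grind

end PartSum

/-- Powers of a vanishing cycle weight appear in the closed formulas through `δ`. -/
theorem delta_natCast (a : ℕ) : delta a = 1 - 0 ^ a := by
  rcases Nat.eq_zero_or_pos a with rfl | ha
  · simp [delta]
  · simp [delta, ha, ha.ne']

theorem delta_natCast_add (a b : ℕ) : delta ((a : ℤ) + (b : ℤ)) = 1 - 0 ^ a * 0 ^ b := by
  rw [← Nat.cast_add, delta_natCast, pow_add]

/-- `0 ^ a` is the indicator of `a = 0`, where `2 ^ a` is `1`. The character sums
match the closed formulas only modulo this relation. -/
theorem two_pow_mul_zero_pow (a : ℕ) : (2 : ℚ) ^ a * 0 ^ a = 0 ^ a := by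
  rw [← mul_pow, mul_zero]

theorem four_pow_eq (a : ℕ) : (4 : ℚ) ^ a = (2 ^ a) ^ 2 := by
  rw [← pow_mul, mul_comm, pow_mul]
  norm_num

theorem eight_pow_eq (a : ℕ) : (8 : ℚ) ^ a = (2 ^ a) ^ 3 := by
  rw [← pow_mul, mul_comm, pow_mul]
  norm_num

theorem neg_two_pow_eq (a : ℕ) : (-2 : ℚ) ^ a = (-1) ^ a * 2 ^ a := by
  rw [← mul_pow]
  norm_num

theorem neg_four_pow_eq (a : ℕ) : (-4 : ℚ) ^ a = (-1) ^ a * (2 ^ a) ^ 2 := by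
  rw [← four_pow_eq, ← mul_pow]
  norm_num

theorem two_zpow_two_mul (a : ℕ) : (2 : ℚ) ^ (2 * (a : ℤ)) = (2 ^ a) ^ 2 := by
  rw [mul_comm, zpow_mul, zpow_natCast, zpow_ofNat]

theorem two_zpow_three_mul (a : ℕ) : (2 : ℚ) ^ (3 * (a : ℤ)) = (2 ^ a) ^ 3 := by
  rw [mul_comm, zpow_mul, zpow_natCast, zpow_ofNat]

/-! ### The number of fixed matrices -/

section FixFormula

variable {n : ℕ} {lam : n.Partition} {σ : Equiv.Perm (Fin n)}

/- With `x = 2 ^ a` and `z = 0 ^ a` the relation `x * z = z` gives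
`x ^ k * z - z = (x ^ (k - 1) + ⋯ + 1) * (x * z - z)`; the coefficients of the linear combinations
below are built from these quotients. -/

theorem card_fixSet_zero (hσ : σ.partition.parts = lam.parts) :
    (Nat.card (FixSet (repGL 0) σ) : ℚ) = fixFormula lam 0 := by
  have key := congrArg (Int.cast : ℤ → ℚ) (card_fixSet_eq_sum_weightTable lam σ hσ 0)
  simp only [weightTable_zero, repPeriod, Multiset.map_add, Multiset.map_replicate,
    Multiset.sum_add, Multiset.sum_replicate, nsmul_eq_mul, Finset.prod_range_succ,
    Finset.prod_range_zero] at key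
  norm_num [partSum_self, four_pow_eq, eight_pow_eq, neg_two_pow_eq, neg_four_pow_eq] at key
  simp only [fixFormula, delta_natCast, zpow_sub₀ (two_ne_zero' ℚ), two_zpow_two_mul,
    two_zpow_three_mul, Nat.card_coe_set_eq]
  have hA := two_pow_mul_zero_pow (partSum lam 1 2)
  generalize (2 : ℚ) ^ partSum lam 1 2 = x, (0 : ℚ) ^ partSum lam 1 2 = z,
    (2 : ℚ) ^ partSum lam 0 2 = w at *
  linear_combination key / 64 - 35 / 64 * w ^ 3 * (x ^ 2 + x + 1) * hA

theorem card_fixSet_one (hσ : σ.partition.parts = lam.parts) :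
    (Nat.card (FixSet (repGL 1) σ) : ℚ) = fixFormula lam 1 := by
  have key := congrArg (Int.cast : ℤ → ℚ) (card_fixSet_eq_sum_weightTable lam σ hσ 1)
  simp only [weightTable_one, repPeriod, Multiset.map_add, Multiset.map_replicate,
    Multiset.sum_add, Multiset.sum_replicate, nsmul_eq_mul, Finset.prod_range_succ,
    Finset.prod_range_zero] at key
  norm_num [partSum_self, four_pow_eq, eight_pow_eq, neg_two_pow_eq, neg_four_pow_eq] at key
  simp only [fixFormula, delta_natCast, delta_natCast_add, zpow_sub₀ (two_ne_zero' ℚ),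
    zpow_add₀ (two_ne_zero' ℚ), zpow_natCast, two_zpow_two_mul, two_zpow_three_mul,
    Nat.card_coe_set_eq]
  have hA := two_pow_mul_zero_pow (partSum lam 1 2)
  have hB := two_pow_mul_zero_pow (partSum lam 2 4)
  rw [partSum_one_two_mod_four] at hA ⊢
  simp only [pow_add] at hA ⊢
  generalize (2 : ℚ) ^ partSum lam 1 4 = x₁, (0 : ℚ) ^ partSum lam 1 4 = z₁,
    (-1 : ℚ) ^ partSum lam 1 4 = s₁, (2 : ℚ) ^ partSum lam 3 4 = x₃,
    (0 : ℚ) ^ partSum lam 3 4 = z₃, (-1 : ℚ) ^ partSum lam 3 4 = s₃,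
    (2 : ℚ) ^ partSum lam 2 4 = y, (0 : ℚ) ^ partSum lam 2 4 = z,
    (2 : ℚ) ^ partSum lam 0 4 = w at *
  linear_combination key / 64 - 3 / 16 * w ^ 3 * y ^ 3 * (x₁ * x₃ + 1) * hA -
    1 / 16 * w ^ 3 * (x₁ * x₃) ^ 2 * (y ^ 2 + y + 1) * hB -
    3 / 16 * w ^ 3 * ((x₁ * x₃ + 1) * y ^ 3 * z * hA + z₁ * z₃ * (y ^ 2 + y + 1) * hB)

theorem card_fixSet_two (hσ : σ.partition.parts = lam.parts) :
    (Nat.card (FixSet (repGL 2) σ) : ℚ) = fixFormula lam 2 := by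
  have key := congrArg (Int.cast : ℤ → ℚ) (card_fixSet_eq_sum_weightTable lam σ hσ 2)
  simp only [weightTable_two, repPeriod, Multiset.map_add, Multiset.map_replicate,
    Multiset.sum_add, Multiset.sum_replicate, nsmul_eq_mul, Finset.prod_range_succ,
    Finset.prod_range_zero] at key
  norm_num [partSum_self, four_pow_eq, eight_pow_eq, neg_two_pow_eq, neg_four_pow_eq] at key
  simp only [fixFormula, delta_natCast_add, zpow_sub₀ (two_ne_zero' ℚ),
    zpow_add₀ (two_ne_zero' ℚ), zpow_natCast, two_zpow_two_mul, two_zpow_three_mul,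
    Nat.card_coe_set_eq]
  have hA := two_pow_mul_zero_pow (partSum lam 1 2)
  have hB := two_pow_mul_zero_pow (partSum lam 2 4)
  have hC := two_pow_mul_zero_pow (partSum lam 4 8)
  have key' : 64 * ((FixSet (repGL 2) σ).ncard : ℚ) = 16 * (2 ^ partSum lam 0 8) ^ 3 *
      (2 ^ partSum lam 1 2 * (2 ^ partSum lam 2 4) ^ 2 * (2 ^ partSum lam 4 8) ^ 3 +
        0 ^ partSum lam 1 2 * 0 ^ partSum lam 2 4 * (2 ^ partSum lam 4 8) ^ 3 +
        0 ^ partSum lam 1 2 * (2 ^ partSum lam 2 4) ^ 2 * 0 ^ partSum lam 4 8 +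
        2 ^ partSum lam 1 2 * 0 ^ partSum lam 2 4 * 0 ^ partSum lam 4 8) := by
    rw [key, partSum_one_two_mod_eight, partSum_two_four_mod_eight]
    simp only [pow_add]
    ring
  simp only [partSum_zero_four_mod_eight lam, pow_add]
  generalize (2 : ℚ) ^ partSum lam 1 2 = x, (0 : ℚ) ^ partSum lam 1 2 = z₁,
    (2 : ℚ) ^ partSum lam 2 4 = y, (0 : ℚ) ^ partSum lam 2 4 = z₂,
    (2 : ℚ) ^ partSum lam 4 8 = u, (0 : ℚ) ^ partSum lam 4 8 = z₄,
    (2 : ℚ) ^ partSum lam 0 8 = w at *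
  linear_combination key' / 64 -
    u ^ 3 * w ^ 3 / 4 * (y ^ 2 * z₂ * hA + z₁ * (y + 1) * hB) -
    y ^ 2 * w ^ 3 / 4 * (u ^ 3 * z₄ * hA + z₁ * (u ^ 2 + u + 1) * hC) -
    x * w ^ 3 / 4 * ((y + 1) * u ^ 3 * z₄ * hB + z₂ * (u ^ 2 + u + 1) * hC)

theorem card_fixSet_three (hσ : σ.partition.parts = lam.parts) :
    (Nat.card (FixSet (repGL 3) σ) : ℚ) = fixFormula lam 3 := by
  have key := congrArg (Int.cast : ℤ → ℚ) (card_fixSet_eq_sum_weightTable lam σ hσ 3)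
  simp only [weightTable_three, repPeriod, Multiset.map_add, Multiset.map_replicate,
    Multiset.sum_add, Multiset.sum_replicate, nsmul_eq_mul, Finset.prod_range_succ,
    Finset.prod_range_zero] at key
  norm_num [partSum_self, four_pow_eq, eight_pow_eq, neg_two_pow_eq, neg_four_pow_eq] at key
  simp only [fixFormula, delta_natCast, zpow_sub₀ (two_ne_zero' ℚ),
    zpow_add₀ (two_ne_zero' ℚ), zpow_natCast, two_zpow_two_mul, Nat.card_coe_set_eq]
  have h₁ := two_pow_mul_zero_pow (partSum lam 1 6)
  have h₃ := two_pow_mul_zero_pow (partSum lam 3 6)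
  have h₅ := two_pow_mul_zero_pow (partSum lam 5 6)
  have hs : (-1 : ℚ) ^ partSum lam 3 6 * 0 ^ partSum lam 3 6 = 0 ^ partSum lam 3 6 := by
    rw [← mul_pow, mul_zero]
  rw [partSum_zero_one_mod_six, partSum_one_two_mod_six]
  simp only [pow_add]
  generalize (2 : ℚ) ^ partSum lam 1 6 = x₁, (0 : ℚ) ^ partSum lam 1 6 = z₁,
    (2 : ℚ) ^ partSum lam 3 6 = x₃, (0 : ℚ) ^ partSum lam 3 6 = z₃,
    (2 : ℚ) ^ partSum lam 5 6 = x₅, (0 : ℚ) ^ partSum lam 5 6 = z₅,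
    (-1 : ℚ) ^ partSum lam 3 6 = s, (2 : ℚ) ^ partSum lam 2 6 = y₂,
    (2 : ℚ) ^ partSum lam 4 6 = y₄, (2 : ℚ) ^ partSum lam 0 6 = w at *
  linear_combination key / 64 - y₂ * y₄ * w ^ 3 / 4 *
    (x₃ ^ 3 * x₅ * z₃ * z₅ * h₁ + x₃ ^ 3 * z₁ * z₃ * h₅ +
      (x₃ ^ 2 + x₃ + 1) * z₁ * z₅ * h₃ +
      s * x₃ ^ 2 * x₅ * z₃ * z₅ * h₁ + s * x₃ ^ 2 * z₁ * z₃ * h₅ +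
      s * (x₃ + 1) * z₁ * z₅ * h₃ + z₁ * z₅ * hs)

theorem card_fixSet_four (hσ : σ.partition.parts = lam.parts) :
    (Nat.card (FixSet (repGL 4) σ) : ℚ) = fixFormula lam 4 := by
  have key := congrArg (Int.cast : ℤ → ℚ) (card_fixSet_eq_sum_weightTable lam σ hσ 4)
  simp only [weightTable_four, repPeriod, Multiset.map_replicate,
    Multiset.sum_replicate, nsmul_eq_mul, Finset.prod_range_succ,
    Finset.prod_range_zero] at key
  norm_num [partSum_self, four_pow_eq, eight_pow_eq, neg_two_pow_eq, neg_four_pow_eq] at key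
  rw [Nat.card_coe_set_eq, key, fixFormula, two_zpow_three_mul]

theorem card_fixSet_five (hσ : σ.partition.parts = lam.parts) :
    (Nat.card (FixSet (repGL 5) σ) : ℚ) = fixFormula lam 5 := by
  have key := congrArg (Int.cast : ℤ → ℚ) (card_fixSet_eq_sum_weightTable lam σ hσ 5)
  simp only [weightTable_five, repPeriod, Multiset.map_replicate,
    Multiset.sum_replicate, nsmul_eq_mul, Finset.prod_range_succ,
    Finset.prod_range_zero] at key
  norm_num [partSum_self, four_pow_eq, eight_pow_eq, neg_two_pow_eq, neg_four_pow_eq] at key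
  rw [Nat.card_coe_set_eq, key, fixFormula, two_zpow_three_mul]

theorem card_fixSet_eq_fixFormula (hσ : σ.partition.parts = lam.parts) (i : Fin 6) :
    (Nat.card (FixSet (repGL i) σ) : ℚ) = fixFormula lam i := by
  fin_cases i
  exacts [card_fixSet_zero hσ, card_fixSet_one hσ, card_fixSet_two hσ, card_fixSet_three hσ,
    card_fixSet_four hσ, card_fixSet_five hσ]

end FixFormula

/-! ### Conjugacy classes of a finite group -/

section ConjClasses

variable {G : Type*} [Group G] [Finite G]

theorem card_isConj_mul_card_centralizer (g : G) :
    Nat.card {h : G // IsConj g h} * Nat.card (Subgroup.centralizer {g}) = Nat.card G := by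
  classical
  have := Fintype.ofFinite G
  rw [Subgroup.nat_card_centralizer_nat_card_stabilizer]
  have h := MulAction.card_orbit_mul_card_stabilizer_eq_card_group (ConjAct G) g
  rw [← Nat.card_eq_fintype_card, ← Nat.card_eq_fintype_card, ← Nat.card_eq_fintype_card] at h
  rw [show Nat.card G = Nat.card (ConjAct G) from rfl, ← h]
  congr 1
  refine Nat.card_congr (Equiv.subtypeEquivRight fun b => ?_)
  rw [ConjAct.mem_orbit_conjAct, isConj_comm]

/-- The sum of a class function in terms of a set of representatives of the conjugacy classes. -/
theorem sum_eq_card_mul_sum_div_card_centralizer [Fintype G] {ι : Type*} [Fintype ι] {r : ι → G}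
    (hr : ∀ g, ∃! i, IsConj (r i) g) {f : G → ℚ} (hf : ∀ g h, IsConj g h → f g = f h) :
    ∑ g, f g =
      Nat.card G * ∑ i, f (r i) / (Nat.card (Subgroup.centralizer {r i}) : ℚ) := by
  classical
  choose c hc huniq using hr
  rw [← Finset.sum_fiberwise Finset.univ c f, Finset.mul_sum]
  refine Finset.sum_congr rfl fun i _ => ?_
  have hiff : ∀ g, c g = i ↔ IsConj (r i) g :=
    fun g => ⟨fun h => h ▸ hc g, fun h => (huniq g i h).symm⟩
  have hconst : ∀ g ∈ Finset.univ.filter (fun g => c g = i), f g = f (r i) := fun g hg =>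
    (hf _ _ ((hiff g).mp (Finset.mem_filter.mp hg).2)).symm
  rw [Finset.sum_congr rfl hconst, Finset.sum_const, card_filter_univ_eq_natCard, nsmul_eq_mul,
    ← card_isConj_mul_card_centralizer (r i), Nat.card_congr (Equiv.subtypeEquivRight hiff)]
  have hpos : (Nat.card (Subgroup.centralizer {r i}) : ℚ) ≠ 0 := by
    exact_mod_cast Nat.card_pos.ne'
  push_cast
  field_simp

end ConjClasses

/-! ### The conjugacy classes of `GL(3, 𝔽₂)` -/

/-- The elements of `GL(3, 𝔽₂)` that conjugate `Aᵢ` into `Aⱼ`, as plain matrices. The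
determinant is expanded so that the set can be enumerated. -/
def intertwiners (i j : Fin 6) : Finset (Matrix (Fin 3) (Fin 3) (ZMod 2)) :=
  Finset.univ.filter fun M =>
    M 0 0 * M 1 1 * M 2 2 - M 0 0 * M 1 2 * M 2 1 - M 0 1 * M 1 0 * M 2 2 +
      M 0 1 * M 1 2 * M 2 0 + M 0 2 * M 1 0 * M 2 1 - M 0 2 * M 1 1 * M 2 0 ≠ 0 ∧
    M * repMatrix i = repMatrix j * M

/-- Computes the centralizers (`i = j`) and shows that distinct `Aᵢ` are not conjugate (`i ≠ j`). -/
theorem card_intertwiners :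
    ∀ i j : Fin 6, (intertwiners i j).card = if i = j then centOrder i else 0 := by
  decide +kernel

theorem mem_intertwiners {i j : Fin 6} {M : Matrix (Fin 3) (Fin 3) (ZMod 2)} :
    M ∈ intertwiners i j ↔ M.det ≠ 0 ∧ M * repMatrix i = repMatrix j * M := by
  rw [intertwiners, Finset.mem_filter, Matrix.det_fin_three]
  simp

theorem card_centralizer_repGL (i : Fin 6) :
    Nat.card (Subgroup.centralizer {repGL i}) = centOrder i := by
  have h := card_intertwiners i i
  rw [if_pos rfl] at h
  rw [← h, ← Nat.card_eq_finsetCard]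
  refine Nat.card_congr
    { toFun := fun g => ⟨g.1.1, mem_intertwiners.mpr ⟨Matrix.GeneralLinearGroup.det_ne_zero g.1, ?_⟩⟩
      invFun := fun M => ⟨Matrix.GeneralLinearGroup.mkOfDetNeZero M.1
        (mem_intertwiners.mp M.2).1, ?_⟩
      left_inv := fun g => Subtype.ext (Units.ext rfl)
      right_inv := fun M => rfl }
  · exact congrArg Units.val (Subgroup.mem_centralizer_singleton_iff.mp g.2)
  · exact Subgroup.mem_centralizer_singleton_iff.mpr (Units.ext (mem_intertwiners.mp M.2).2)

theorem eq_of_isConj_repGL {i j : Fin 6} (h : IsConj (repGL i) (repGL j)) : i = j := by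
  obtain ⟨c, hc⟩ := isConj_iff.mp h
  have hmem : c.1 ∈ intertwiners i j := by
    refine mem_intertwiners.mpr ⟨Matrix.GeneralLinearGroup.det_ne_zero c, ?_⟩
    exact congrArg Units.val (mul_inv_eq_iff_eq_mul.mp hc)
  by_contra hij
  have hcard := card_intertwiners i j
  rw [if_neg hij, Finset.card_eq_zero] at hcard
  simp [hcard] at hmem

theorem card_GL_three_zmod_two : Nat.card (GL (Fin 3) (ZMod 2)) = 168 := by
  have h := Matrix.card_GL_field (𝔽 := ZMod 2) 3
  simpa [Fin.prod_univ_three, ZMod.card] using h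

/-- The six classes are disjoint and their sizes add up to the order of the group, so that they
exhaust it. -/
theorem existsUnique_isConj_repGL (B : GL (Fin 3) (ZMod 2)) : ∃! i, IsConj (repGL i) B := by
  classical
  have huniq : ∀ i j, IsConj (repGL i) B → IsConj (repGL j) B → i = j :=
    fun i j hi hj => eq_of_isConj_repGL (hi.trans hj.symm)
  suffices h : ∃ i, IsConj (repGL i) B by
    obtain ⟨i, hi⟩ := h
    exact ⟨i, hi, fun j hj => huniq j i hj hi⟩
  have hinj : Function.Injective
      (fun p : (i : Fin 6) × {g : GL (Fin 3) (ZMod 2) // IsConj (repGL i) g} => p.2.1) := by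
    rintro ⟨i, g, hg⟩ ⟨j, h, hh⟩ (rfl : g = h)
    obtain rfl := eq_of_isConj_repGL (hg.trans hh.symm)
    rfl
  have hcard : Nat.card ((i : Fin 6) × {g : GL (Fin 3) (ZMod 2) // IsConj (repGL i) g}) =
      Nat.card (GL (Fin 3) (ZMod 2)) := by
    rw [Nat.card_sigma, card_GL_three_zmod_two]
    have hmul := fun i => card_isConj_mul_card_centralizer (repGL i)
    simp only [card_centralizer_repGL, card_GL_three_zmod_two] at hmul
    have h0 := hmul 0
    have h1 := hmul 1
    have h2 := hmul 2
    have h3 := hmul 3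
    have h4 := hmul 4
    have h5 := hmul 5
    simp only [centOrder] at h0 h1 h2 h3 h4 h5
    simp only [Fin.sum_univ_six]
    omega
  have hsurj := ((Nat.bijective_iff_injective_and_card _).mpr ⟨hinj, hcard⟩).2
  obtain ⟨⟨i, g, hg⟩, rfl⟩ := hsurj B
  exact ⟨i, hg⟩

/-! ### The conjugacy classes of the symmetric group -/

/-- Fixed points count as cycles of length `1` in `lam`, but are absent from `cycleType`. -/
theorem card_centralizer_eq_centSymOrder {n : ℕ} {lam : n.Partition} {σ : Equiv.Perm (Fin n)}
    (hσ : σ.partition.parts = lam.parts) :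
    Nat.card (Subgroup.centralizer {σ}) = centSymOrder lam := by
  have hparts := parts_partition_eq σ
  rw [hσ, Fintype.card_fin] at hparts
  have hsum := σ.sum_cycleType_le
  rw [Fintype.card_fin] at hsum
  have hle : ∀ i ∈ lam.parts, i ∈ Finset.Icc 1 n := fun i hi =>
    Finset.mem_Icc.mpr ⟨lam.parts_pos hi,
      (Multiset.single_le_sum (fun _ _ => Nat.zero_le _) i hi).trans lam.parts_sum.le⟩
  have hone : Multiset.count 1 σ.cycleType = 0 :=
    Multiset.count_eq_zero_of_notMem fun h =>
      absurd (Equiv.Perm.two_le_of_mem_cycleType h) (by norm_num)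
  rw [Equiv.Perm.nat_card_centralizer, Fintype.card_fin, centSymOrder, Finset.prod_mul_distrib]
  set m := n - σ.cycleType.sum with hm
  have hpow : ∏ i ∈ Finset.Icc 1 n, i ^ partMult lam i = σ.cycleType.prod := by
    have h1 : lam.parts.prod = σ.cycleType.prod := by
      rw [hparts, Multiset.prod_add, Multiset.prod_replicate, one_pow, mul_one]
    rw [← h1, Finset.prod_multiset_count]
    refine (Finset.prod_subset (fun i hi => hle i (Multiset.mem_toFinset.mp hi))
      fun i _ hi => ?_).symm
    rw [Multiset.mem_toFinset] at hi
    rw [partMult, Multiset.count_eq_zero_of_notMem hi, pow_zero]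
  have hfact : ∏ i ∈ Finset.Icc 1 n, (partMult lam i)! =
      m ! * ∏ i ∈ σ.cycleType.toFinset, (σ.cycleType.count i)! := by
    have h1 : ∀ i, (partMult lam i)! =
        (Multiset.count i (Multiset.replicate m 1))! * (σ.cycleType.count i)! := by
      intro i
      rw [partMult, hparts, Multiset.count_add]
      by_cases hi : i = 1
      · rw [hi, hone]
        simp
      · rw [Multiset.count_replicate, if_neg (Ne.symm hi)]
        simp
    simp only [h1, Finset.prod_mul_distrib]
    congr 1
    · rw [Finset.prod_eq_single 1, Multiset.count_replicate_self]
      · intro i _ hi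
        rw [Multiset.count_replicate, if_neg (Ne.symm hi), Nat.factorial_zero]
      · intro h
        have : m = 0 := by
          rw [Finset.mem_Icc] at h
          omega
        simp [this]
    · refine (Finset.prod_subset (fun i hi => hle i ?_) fun i _ hi => ?_).symm
      · rw [hparts]
        exact Multiset.mem_add.mpr (Or.inl (Multiset.mem_toFinset.mp hi))
      · rw [Multiset.mem_toFinset] at hi
        rw [Multiset.count_eq_zero_of_notMem hi, Nat.factorial_zero]
  rw [hpow, hfact]
  ring

/-- A permutation with the given cycle type. -/
noncomputable def permOfPartition {n : ℕ} (lam : n.Partition) : Equiv.Perm (Fin n) :=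
  (exists_perm_parts_partition_eq lam).choose

theorem parts_partition_permOfPartition {n : ℕ} (lam : n.Partition) :
    (permOfPartition lam).partition.parts = lam.parts :=
  (exists_perm_parts_partition_eq lam).choose_spec

theorem isConj_iff_parts_partition_eq {n : ℕ} {σ τ : Equiv.Perm (Fin n)} :
    IsConj σ τ ↔ σ.partition.parts = τ.partition.parts := by
  rw [Equiv.Perm.partition_eq_of_isConj, Nat.Partition.ext_iff]

theorem existsUnique_isConj_permOfPartition {n : ℕ} (σ : Equiv.Perm (Fin n)) :
    ∃! lam : n.Partition, IsConj (permOfPartition lam) σ := by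
  simp only [isConj_iff_parts_partition_eq, parts_partition_permOfPartition]
  refine ⟨⟨σ.partition.parts, σ.partition.parts_pos, ?_⟩, rfl, fun lam h => Nat.Partition.ext h⟩
  rw [σ.partition.parts_sum, Fintype.card_fin]

/-! ### Codes as orbits of generating matrices -/

/-- Two surjections from the same finite-dimensional space differ by an automorphism. -/
theorem exists_linearEquiv_comp_eq_of_surjective {K E F : Type*} [Field K] [AddCommGroup E]
    [Module K E] [FiniteDimensional K E] [AddCommGroup F] [Module K F] {f g : E →ₗ[K] F}
    (hf : Function.Surjective f) (hg : Function.Surjective g) :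
    ∃ e : E ≃ₗ[K] E, ∀ x, g x = f (e x) := by
  have hrank : ∀ h : E →ₗ[K] F, Function.Surjective h →
      Module.finrank K F + Module.finrank K (LinearMap.ker h) = Module.finrank K E := by
    intro h hh
    rw [← h.finrank_range_add_finrank_ker, LinearMap.range_eq_top.mpr hh, finrank_top]
  have hsplit : ∀ h : E →ₗ[K] F, Function.Surjective h →
      ∃ e : E ≃ₗ[K] F × LinearMap.ker h, ∀ x, (e x).1 = h x := by
    intro h hh
    obtain ⟨q, hq⟩ := (LinearMap.ker h).exists_isCompl
    refine ⟨LinearMap.equivProdOfSurjectiveOfIsCompl h (Submodule.projectionOnto _ q hq)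
      (LinearMap.range_eq_top.mpr hh) (Submodule.range_projectionOnto hq) ?_, fun x => rfl⟩
    rwa [Submodule.ker_projectionOnto]
  obtain ⟨ef, hef⟩ := hsplit f hf
  obtain ⟨eg, heg⟩ := hsplit g hg
  let k : LinearMap.ker g ≃ₗ[K] LinearMap.ker f := LinearEquiv.ofFinrankEq _ _ <| by
    have h1 := hrank f hf
    have h2 := hrank g hg
    omega
  refine ⟨(eg.trans ((LinearEquiv.refl K F).prodCongr k)).trans ef.symm, fun x => ?_⟩
  rw [← hef, ← heg]
  simp

/-- The code generated by the rows of a matrix. -/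
def rowCode {k n : ℕ} (X : Matrix (Fin k) (Fin n) (ZMod 2)) :
    Submodule (ZMod 2) (Fin n → ZMod 2) :=
  LinearMap.range X.vecMulLinear

theorem isSelfOrthogonal_rowCode_iff {k n : ℕ} {X : Matrix (Fin k) (Fin n) (ZMod 2)} :
    IsSelfOrthogonal (rowCode X) ↔ X ∈ selfOrthMatrices k n := by
  constructor
  · intro h
    ext i j
    have hrow : ∀ i, X i ∈ rowCode X := fun i =>
      ⟨Pi.single i 1, by rw [Matrix.vecMulLinear_apply, Matrix.single_one_vecMul]; rfl⟩
    exact h _ (hrow i) _ (hrow j)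
  · rintro h _ ⟨v, rfl⟩ _ ⟨w, rfl⟩
    have h' : X * X.transpose = 0 := h
    rw [Matrix.vecMulLinear_apply, Matrix.vecMulLinear_apply, ← Matrix.dotProduct_mulVec,
      ← Matrix.mulVec_transpose, Matrix.mulVec_mulVec, h', Matrix.zero_mulVec, dotProduct_zero]

theorem finrank_rowCode_le {k n : ℕ} (X : Matrix (Fin k) (Fin n) (ZMod 2)) :
    Module.finrank (ZMod 2) (rowCode X) ≤ k :=
  (LinearMap.finrank_range_le _).trans (Module.finrank_fin_fun _).le

theorem exists_rowCode_eq {k n : ℕ} (C : Submodule (ZMod 2) (Fin n → ZMod 2))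
    (hC : Module.finrank (ZMod 2) C ≤ k) :
    ∃ X : Matrix (Fin k) (Fin n) (ZMod 2), rowCode X = C := by
  obtain ⟨f, hf⟩ : ∃ f : (Fin k → ZMod 2) →ₗ[ZMod 2] C, Function.Surjective f :=
    ⟨(Module.finBasis (ZMod 2) C).equivFun.symm.toLinearMap ∘ₗ
        LinearMap.funLeft (ZMod 2) (ZMod 2) (Fin.castLE hC),
      (Module.finBasis (ZMod 2) C).equivFun.symm.surjective.comp
        (LinearMap.funLeft_surjective_of_injective _ _ _ (Fin.castLE_injective hC))⟩
  refine ⟨LinearMap.toMatrixRight' (C.subtype ∘ₗ f), ?_⟩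
  change LinearMap.range (Matrix.toLinearMapRight' (LinearMap.toMatrixRight' _)) = C
  rw [LinearEquiv.symm_apply_apply, LinearMap.range_comp, LinearMap.range_eq_top.mpr hf,
    Submodule.map_top, Submodule.range_subtype]

/-- The column operation by the matrix of `σ` is `v ↦ v ∘ σ⁻¹`, hence the inverse on the right. -/
theorem rowCode_mul_mul_permMatrix {k n : ℕ} (A : GL (Fin k) (ZMod 2)) (σ : Equiv.Perm (Fin n))
    (X : Matrix (Fin k) (Fin n) (ZMod 2)) :
    rowCode (A.1 * X * σ.permMatrix (ZMod 2)) = permuteCode σ⁻¹ (rowCode X) := by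
  have hσ : ∀ v : Fin n → ZMod 2, Matrix.vecMul v (σ.permMatrix (ZMod 2)) = v ∘ σ.symm := by
    intro v
    exact PEquiv.vecMul_toMatrix_toPEquiv _ _
  ext y
  constructor
  · rintro ⟨v, rfl⟩
    refine ⟨Matrix.vecMul (Matrix.vecMul v A.1) X, ⟨_, rfl⟩, ?_⟩
    rw [Matrix.vecMulLinear_apply, ← Matrix.vecMul_vecMul, hσ, ← Matrix.vecMul_vecMul]
    rfl
  · rintro ⟨_, ⟨v, rfl⟩, rfl⟩
    refine ⟨Matrix.vecMul v (A⁻¹).1, ?_⟩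
    rw [Matrix.vecMulLinear_apply, ← Matrix.vecMul_vecMul, hσ, ← Matrix.vecMul_vecMul,
      Matrix.vecMul_vecMul v, ← Units.val_mul, inv_mul_cancel, Units.val_one, Matrix.vecMul_one]
    rfl

theorem exists_GL_mul_eq_of_rowCode_eq {k n : ℕ} {X Y : Matrix (Fin k) (Fin n) (ZMod 2)}
    (h : rowCode X = rowCode Y) : ∃ A : GL (Fin k) (ZMod 2), A.1 * X = Y := by
  obtain ⟨e, he⟩ := exists_linearEquiv_comp_eq_of_surjective
    (f := X.vecMulLinear.rangeRestrict)
    (g := Y.vecMulLinear.codRestrict (LinearMap.range X.vecMulLinear) fun v => by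
      change _ ∈ rowCode X
      rw [h]
      exact ⟨v, rfl⟩)
    X.vecMulLinear.surjective_rangeRestrict
    (by
      rintro ⟨y, hy⟩
      obtain ⟨v, rfl⟩ : y ∈ rowCode Y := h ▸ hy
      exact ⟨v, rfl⟩)
  have he' : ∀ v, Matrix.vecMul v Y = Matrix.vecMul (e v) X := fun v => congrArg Subtype.val (he v)
  refine ⟨⟨LinearMap.toMatrixRight' e.toLinearMap, LinearMap.toMatrixRight' e.symm.toLinearMap,
    ?_, ?_⟩, ?_⟩
  · rw [← LinearMap.toMatrixRight'_comp, LinearEquiv.symm_comp, LinearMap.toMatrixRight'_id]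
  · rw [← LinearMap.toMatrixRight'_comp, LinearEquiv.comp_symm, LinearMap.toMatrixRight'_id]
  · refine Matrix.toLinearMapRight'.injective (LinearMap.ext fun v => ?_)
    rw [Matrix.toLinearMapRight'_mul_apply, LinearEquiv.symm_apply_apply]
    exact (he' v).symm

/-! ### Counting codes by orbit counting -/

theorem permMatrix_mul_transpose {n : ℕ} (σ : Equiv.Perm (Fin n)) :
    σ.permMatrix (ZMod 2) * (σ.permMatrix (ZMod 2)).transpose = 1 := by
  rw [Matrix.transpose_permMatrix, ← Matrix.permMatrix_mul, inv_mul_cancel, Matrix.permMatrix_one]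

/-- The action of `GL(k, 𝔽₂) × 𝔖ₙ` on the generating matrices of self-orthogonal codes. -/
instance selfOrthMatricesAction (k n : ℕ) :
    MulAction (GL (Fin k) (ZMod 2) × Equiv.Perm (Fin n)) (selfOrthMatrices k n) where
  smul g X := ⟨g.1.1 * X.1 * g.2.permMatrix (ZMod 2), by
    have hX : X.1 * X.1.transpose = 0 := X.2
    change g.1.1 * X.1 * g.2.permMatrix (ZMod 2) *
      (g.1.1 * X.1 * g.2.permMatrix (ZMod 2)).transpose = 0
    rw [Matrix.transpose_mul, Matrix.transpose_mul, Matrix.mul_assoc,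
      ← Matrix.mul_assoc (g.2.permMatrix (ZMod 2)), permMatrix_mul_transpose, Matrix.one_mul,
      ← Matrix.mul_assoc, Matrix.mul_assoc g.1.1, hX, Matrix.mul_zero, Matrix.zero_mul]⟩
  one_smul X := Subtype.ext <| by
    change (1 : Matrix (Fin k) (Fin k) (ZMod 2)) * X.1 * (1 : Equiv.Perm (Fin n)).permMatrix _ = X.1
    rw [Matrix.permMatrix_one, Matrix.one_mul, Matrix.mul_one]
  mul_smul g h X := Subtype.ext <| by
    change g.1.1 * h.1.1 * X.1 * (g.2 * h.2).permMatrix (ZMod 2) =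
      g.1.1 * (h.1.1 * X.1 * h.2.permMatrix (ZMod 2)) * g.2.permMatrix (ZMod 2)
    rw [Matrix.permMatrix_mul]
    simp only [Matrix.mul_assoc]

/-- `FixSet A σ` involves `A⁻¹`, hence is the fixed set of `(A⁻¹, σ)`. -/
theorem card_fixedBy_eq_card_fixSet {k n : ℕ} (A : GL (Fin k) (ZMod 2)) (σ : Equiv.Perm (Fin n)) :
    Nat.card (MulAction.fixedBy (selfOrthMatrices k n) (A⁻¹, σ)) = Nat.card (FixSet A σ) :=
  Nat.card_congr
    { toFun := fun X => ⟨X.1.1, X.1.2, congrArg Subtype.val X.2⟩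
      invFun := fun X => ⟨⟨X.1, X.2.1⟩, Subtype.ext X.2.2⟩
      left_inv := fun _ => rfl
      right_inv := fun _ => rfl }

theorem card_fixedBy_eq_of_isConj {G α : Type*} [Group G] [MulAction G α] {g h : G}
    (hgh : IsConj g h) :
    Nat.card (MulAction.fixedBy α g) = Nat.card (MulAction.fixedBy α h) := by
  obtain ⟨c, rfl⟩ := isConj_iff.mp hgh
  rw [← MulAction.smul_fixedBy]
  exact (Set.natCard_smul_set _ _).symm

theorem card_fixSet_eq_of_isConj_left {k n : ℕ} {A B : GL (Fin k) (ZMod 2)} (h : IsConj A B)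
    (σ : Equiv.Perm (Fin n)) : Nat.card (FixSet A σ) = Nat.card (FixSet B σ) := by
  rw [← card_fixedBy_eq_card_fixSet, ← card_fixedBy_eq_card_fixSet]
  refine card_fixedBy_eq_of_isConj ?_
  obtain ⟨c, rfl⟩ := isConj_iff.mp h
  exact isConj_iff.mpr ⟨(c, 1), Prod.ext (by simp [mul_assoc]) (by simp)⟩

theorem card_fixSet_eq_of_isConj_right {k n : ℕ} (A : GL (Fin k) (ZMod 2))
    {σ τ : Equiv.Perm (Fin n)} (h : IsConj σ τ) :
    Nat.card (FixSet A σ) = Nat.card (FixSet A τ) := by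
  rw [← card_fixedBy_eq_card_fixSet, ← card_fixedBy_eq_card_fixSet]
  refine card_fixedBy_eq_of_isConj ?_
  obtain ⟨c, rfl⟩ := isConj_iff.mp h
  exact isConj_iff.mpr ⟨(1, c), Prod.ext (by simp) (by simp)⟩

/-- Equivalence classes of codes of dimension at most `k` are orbits of generating matrices. -/
theorem PsiLE_eq_card_orbits (k n : ℕ) :
    PsiLE k n = Nat.card (MulAction.orbitRel.Quotient (GL (Fin k) (ZMod 2) × Equiv.Perm (Fin n))
      (selfOrthMatrices k n)) := by
  let gen : selfOrthMatrices k n → {C : Submodule (ZMod 2) (Fin n → ZMod 2) //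
      IsSelfOrthogonal C ∧ Module.finrank (ZMod 2) C ≤ k} :=
    fun X => ⟨rowCode X.1, isSelfOrthogonal_rowCode_iff.mpr X.2, finrank_rowCode_le X.1⟩
  have hgen : ∀ X Y : selfOrthMatrices k n,
      MulAction.orbitRel (GL (Fin k) (ZMod 2) × Equiv.Perm (Fin n)) _ X Y ↔
        ((codeSetoid n).comap Subtype.val) (gen X) (gen Y) := by
    intro X Y
    constructor
    · rintro ⟨⟨A, σ⟩, rfl⟩
      refine (codeSetoid n).symm ⟨σ⁻¹, ?_⟩
      exact rowCode_mul_mul_permMatrix A σ Y.1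
    · rintro ⟨σ, hσ⟩
      have hσ' : rowCode Y.1 = permuteCode σ (rowCode X.1) := hσ
      have h1 := rowCode_mul_mul_permMatrix 1 σ⁻¹ X.1
      rw [inv_inv, ← hσ'] at h1
      obtain ⟨A, hA⟩ := exists_GL_mul_eq_of_rowCode_eq h1
      refine (MulAction.orbitRel _ _).symm ⟨(A, σ⁻¹), Subtype.ext ?_⟩
      change A.1 * X.1 * _ = Y.1
      rw [← hA, Units.val_one, Matrix.one_mul, Matrix.mul_assoc]
  refine (Nat.card_eq_of_bijective (Quotient.map gen fun X Y h => (hgen X Y).mp h) ⟨?_, ?_⟩).symm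
  · rintro ⟨X⟩ ⟨Y⟩ h
    exact Quotient.sound ((hgen X Y).mpr (Quotient.exact h))
  · rintro ⟨C, hC, hk⟩
    obtain ⟨X, rfl⟩ := exists_rowCode_eq C hk
    exact ⟨Quotient.mk _ ⟨X, isSelfOrthogonal_rowCode_iff.mp hC⟩, rfl⟩

/-- Burnside's lemma, with the sum over the group collected by conjugacy classes in each factor. -/
theorem PsiLE_three_eq (n : ℕ) :
    (PsiLE 3 n : ℚ) =
      ∑ i : Fin 6, 1 / (centOrder i : ℚ) *
        ∑ lam : n.Partition, fixFormula lam i / (centSymOrder lam : ℚ) := by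
  classical
  have burnside : ∑ A : GL (Fin 3) (ZMod 2), ∑ σ : Equiv.Perm (Fin n),
      (Nat.card (FixSet A σ) : ℚ) =
        PsiLE 3 n * (Nat.card (GL (Fin 3) (ZMod 2)) * Nat.card (Equiv.Perm (Fin n))) := by
    have := Fintype.ofFinite (MulAction.orbitRel.Quotient
      (GL (Fin 3) (ZMod 2) × Equiv.Perm (Fin n)) (selfOrthMatrices 3 n))
    have := fun g : GL (Fin 3) (ZMod 2) × Equiv.Perm (Fin n) =>
      Fintype.ofFinite (MulAction.fixedBy (selfOrthMatrices 3 n) g)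
    have h := MulAction.sum_card_fixedBy_eq_card_orbits_mul_card_group
      (GL (Fin 3) (ZMod 2) × Equiv.Perm (Fin n)) (selfOrthMatrices 3 n)
    simp only [← Nat.card_eq_fintype_card] at h
    rw [Nat.card_prod] at h
    rw [PsiLE_eq_card_orbits]
    have h' := congrArg (Nat.cast : ℕ → ℚ) h
    push_cast at h'
    rw [MulAction.orbitRel.Quotient, ← h', Fintype.sum_prod_type]
    refine Fintype.sum_equiv (Equiv.inv (GL (Fin 3) (ZMod 2))) _ _ fun A => ?_
    simp only [Equiv.inv_apply, card_fixedBy_eq_card_fixSet]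
  have hGL : ∀ f : GL (Fin 3) (ZMod 2) → ℚ, (∀ A B, IsConj A B → f A = f B) →
      ∑ A, f A = Nat.card (GL (Fin 3) (ZMod 2)) * ∑ i, f (repGL i) / (centOrder i : ℚ) := by
    intro f hf
    rw [sum_eq_card_mul_sum_div_card_centralizer existsUnique_isConj_repGL hf]
    simp only [card_centralizer_repGL]
  have hPerm : ∀ f : Equiv.Perm (Fin n) → ℚ, (∀ σ τ, IsConj σ τ → f σ = f τ) →
      ∑ σ, f σ = Nat.card (Equiv.Perm (Fin n)) *
        ∑ lam : n.Partition, f (permOfPartition lam) / (centSymOrder lam : ℚ) := by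
    intro f hf
    rw [sum_eq_card_mul_sum_div_card_centralizer existsUnique_isConj_permOfPartition hf]
    simp only [card_centralizer_eq_centSymOrder (parts_partition_permOfPartition _)]
  rw [hGL _ fun A B h => Finset.sum_congr rfl fun σ _ => by
    rw [card_fixSet_eq_of_isConj_left h]] at burnside
  simp only [hPerm _ fun σ τ h => congrArg (Nat.cast : ℕ → ℚ) (card_fixSet_eq_of_isConj_right _ h),
    card_fixSet_eq_fixFormula (parts_partition_permOfPartition _)] at burnside
  have h1 : (Nat.card (GL (Fin 3) (ZMod 2)) : ℚ) ≠ 0 := by exact_mod_cast Nat.card_pos.ne'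
  have h2 : (Nat.card (Equiv.Perm (Fin n)) : ℚ) ≠ 0 := by exact_mod_cast Nat.card_pos.ne'
  rw [← mul_left_inj' (mul_ne_zero h1 h2), ← burnside, Finset.mul_sum, Finset.sum_mul]
  refine Finset.sum_congr rfl fun i _ => ?_
  ring

theorem finrank_permuteCode {n : ℕ} (σ : Equiv.Perm (Fin n))
    (C : Submodule (ZMod 2) (Fin n → ZMod 2)) :
    Module.finrank (ZMod 2) (permuteCode σ C) = Module.finrank (ZMod 2) C :=
  LinearEquiv.finrank_map_eq _ _

/-- Equivalent codes have the same dimension, so classes can be counted dimension by dimension. -/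
theorem Psi_succ_add_PsiLE (k n : ℕ) : Psi (k + 1) n + PsiLE k n = PsiLE (k + 1) n := by
  have hdim : ∀ C₁ C₂, (codeSetoid n) C₁ C₂ →
      Module.finrank (ZMod 2) C₁ = Module.finrank (ZMod 2) C₂ := by
    rintro C₁ _ ⟨σ, rfl⟩
    exact (finrank_permuteCode σ C₁).symm
  let i : {C : Submodule (ZMod 2) (Fin n → ZMod 2) //
      IsSelfOrthogonal C ∧ Module.finrank (ZMod 2) C = k + 1} →
      {C : Submodule (ZMod 2) (Fin n → ZMod 2) //
        IsSelfOrthogonal C ∧ Module.finrank (ZMod 2) C ≤ k + 1} :=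
    fun C => ⟨C.1, C.2.1, C.2.2.le⟩
  let j : {C : Submodule (ZMod 2) (Fin n → ZMod 2) //
      IsSelfOrthogonal C ∧ Module.finrank (ZMod 2) C ≤ k} →
      {C : Submodule (ZMod 2) (Fin n → ZMod 2) //
        IsSelfOrthogonal C ∧ Module.finrank (ZMod 2) C ≤ k + 1} :=
    fun C => ⟨C.1, C.2.1, C.2.2.trans (Nat.le_succ k)⟩
  have hexact : ∀ C D : {C : Submodule (ZMod 2) (Fin n → ZMod 2) //
      IsSelfOrthogonal C ∧ Module.finrank (ZMod 2) C ≤ k + 1},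
      Quotient.mk ((codeSetoid n).comap Subtype.val) C = Quotient.mk _ D →
        (codeSetoid n) C.1 D.1 := fun C D h =>
    Quotient.exact (s := (codeSetoid n).comap Subtype.val) h
  unfold Psi PsiLE
  rw [← Nat.card_sum]
  refine Nat.card_eq_of_bijective (Sum.elim (Quotient.map i fun _ _ h => h)
    (Quotient.map j fun _ _ h => h)) ⟨?_, ?_⟩
  · rintro (⟨⟨C⟩⟩ | ⟨⟨C⟩⟩) (⟨⟨D⟩⟩ | ⟨⟨D⟩⟩) h
    · exact congrArg Sum.inl (Quotient.sound (hexact (i C) (i D) h))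
    · have h0 := hdim _ _ (hexact (i C) (j D) h)
      have h1 : Module.finrank (ZMod 2) (i C).1 = k + 1 := C.2.2
      have h2 : Module.finrank (ZMod 2) (j D).1 ≤ k := D.2.2
      omega
    · have h0 := hdim _ _ (hexact (j C) (i D) h)
      have h1 : Module.finrank (ZMod 2) (i D).1 = k + 1 := D.2.2
      have h2 : Module.finrank (ZMod 2) (j C).1 ≤ k := C.2.2
      omega
    · exact congrArg Sum.inr (Quotient.sound (hexact (j C) (j D) h))
  · rintro ⟨C, hC, hk⟩
    rcases hk.lt_or_eq with h | h
    · exact ⟨Sum.inr (Quotient.mk _ ⟨C, hC, Nat.lt_succ_iff.mp h⟩), rfl⟩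
    · exact ⟨Sum.inl (Quotient.mk _ ⟨C, hC, h⟩), rfl⟩

theorem mainTheorem1 (n : ℕ) :
    -- `A₁, …, A₆` represent the conjugacy classes of `GL(3, 𝔽₂)`, each class exactly once
    (∀ B : GL (Fin 3) (ZMod 2), ∃! i : Fin 6, IsConj (repGL i) B) ∧
    -- the orders of their centralizers
    (∀ i : Fin 6, Nat.card (Subgroup.centralizer {repGL i}) = centOrder i) ∧
    -- every partition of `n` is the cycle type of a permutation
    (∀ lam : n.Partition, ∃ σ : Equiv.Perm (Fin n), σ.partition.parts = lam.parts) ∧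
    -- the size of `Fix(A_i, P)` for every permutation `P` of cycle type `lam`
    (∀ (lam : n.Partition) (σ : Equiv.Perm (Fin n)), σ.partition.parts = lam.parts →
      ∀ i : Fin 6, (Nat.card (FixSet (repGL i) σ) : ℚ) = fixFormula lam i) ∧
    -- the resulting closed formula for `Ψ_{≤3,n}`
    (PsiLE 3 n : ℚ) =
      ∑ i : Fin 6, 1 / (centOrder i : ℚ) *
        ∑ lam : n.Partition, fixFormula lam i / (centSymOrder lam : ℚ) ∧
    -- the number of codes of dimension exactly `3`
    (Psi 3 n : ℤ) = (PsiLE 3 n : ℤ) - (PsiLE 2 n : ℤ) := by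

  refine ⟨existsUnique_isConj_repGL, card_centralizer_repGL, exists_perm_parts_partition_eq,
    fun lam σ hσ i => card_fixSet_eq_fixFormula hσ i, PsiLE_three_eq n, ?_⟩
  rw [← Psi_succ_add_PsiLE 2 n]
  push_cast
  ring
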